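/- Let $(\Omega,\mathcal F,\mathbb P)$ be a probability space, $L^0$ the space of real random variables modulo $\mathbb P$-a.s. equality with the a.s. order, and $L^\infty\subset L^0$ the essentially bounded ones. A \emph{solid space} is a vector subspace $\mathcal X\subset L^0$ such that $|X|\le|Y|$, $Y\in\mathcal X$ imply $X\in\mathcal X$. A \emph{convex risk function} on a solid space $\mathcal X$ containing the constants is a proper convex function $\varphi:\mathcal X\to(-\infty,\infty]$ that is increasing ($X\le Y$ a.s. implies $\varphi(X)\le\varphi(Y)$) and cash-additive ($\varphi(X+c)=\varphi(X)+c$ for $X\in\mathcal X$, $c\in\mathbb R$). It has the \emph{Lebesgue property} on $\mathcal X$ if $\varphi(X_n)\to\varphi(X)$ whenever $X_n\in\mathcal X$, $X_n\to X$ a.s. and $|X_n|\le Y$ for all $n$ and some $0\le Y\in\mathcal X$. Let $\varphi_0$ be a convex risk function on $L^\infty$ with the Lebesgue property and $\varphi_0(0)=0$. Put $\varphi_0^*(Z)=\sup_{X\in L^\infty}(\mathbb E[XZ]-\varphi_0(X))$ for $Z\in L^1$, and for a probability measure $Q\ll\mathbb P$ write $\varphi_0^*(Q)=\varphi_0^*(dQ/d\mathbb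 P)$. Let $\mathcal Q_0=\{Q\ll\mathbb P \text{ probability}:\varphi_0^*(Q)<\infty\}$ and $\mathcal D_0=\{X\in L^0: X^-\in L^1(Q)\ \forall Q\in\mathcal Q_0\}$. Then: (1) The following are well-defined: $$\hat\varphi(X)=\sup_{Q\in\mathcal Q_0}\bigl(\mathbb E_Q[X]-\varphi_0^*(Q)\bigr)\quad (X\in\mathcal D_0),\qquad M^{\hat\varphi}_u=\Bigl\{X\in L^0:\ \lim_{N\to\infty}\hat\varphi\bigl(\alpha|X|\mathbf 1_{\{|X|>N\}}\bigr)=0\ \ \forall\alpha>0\Bigr\}\subset\mathcal D_0\cap(-\mathcal D_0).$$ That is, $\mathcal Q_0\neq\emptyset$, $\varphi_0^*$ is real-valued on $\mathcal Q_0$, $\mathbb E_Q[X]\in(-\infty,\infty]$ for all $X\in\mathcal D_0$ and $Q\in\mathcal Q_0$, $\hat\varphi$ takes values in $(-\infty,\infty]$ on $\mathcal D_0$, $\mathcal D_0$ contains all $X\ge 0$ in $L^0$, and the stated inclusion holds. (2) $M^{\hat\varphi}_u$ is a solid space containing $L^\infty$, $\hat\varphi$ is a finite-valued convex risk function on $M^{\hat\varphi}_u$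 with the Lebesgue property, and $\hat\varphi|_{L^\infty}=\varphi_0$. Moreover, for any pair $(\varphi,\mathcal X)$ of a solid space $\mathcal X\supset L^\infty$ and a convex risk function $\varphi$ on $\mathcal X$ with the Lebesgue property and $\varphi|_{L^\infty}=\varphi_0$, we have $\mathcal X\subset M^{\hat\varphi}_u$ and $\varphi=\hat\varphi|_{\mathcal X}$. -/

import Mathlib

open MeasureTheory Filter Topology
open scoped ENNReal

noncomputable section

namespace RiskFunction

variable {Ω : Type*} [MeasurableSpace Ω]

/-- The space `L⁰(P)` of classes of real random variables modulo `P`-a.s. equality. -/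
abbrev L0 (P : Measure Ω) := Ω →ₘ[P] ℝ

/-- The set of (classes of) essentially bounded random variables. -/
def Linf (P : Measure Ω) : Set (L0 P) := (Lp ℝ ∞ P : Set (L0 P))

/-- A solid space: a vector subspace of `L⁰` such that `|X| ≤ |Y|` and `Y ∈ S` imply `X ∈ S`. -/
structure IsSolidSpace {P : Measure Ω} (S : Set (L0 P)) : Prop where
  isSubspace : ∃ V : Submodule ℝ (L0 P), (V : Set (L0 P)) = S
  solid : ∀ X Y : L0 P, |X| ≤ |Y| → Y ∈ S → X ∈ S

/-- `φ` restricted to `S` is a proper convex function with values in `(-∞, ∞]` that is increasing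
for the a.s. order. The values of `φ` outside `S` play no role. -/
structure IsMonotoneConvexOn {P : Measure Ω} (S : Set (L0 P)) (φ : L0 P → EReal) : Prop where
  ne_bot : ∀ X ∈ S, φ X ≠ ⊥
  proper : ∃ X ∈ S, φ X ≠ ⊤
  convex : ∀ X ∈ S, ∀ Y ∈ S, ∀ a b : ℝ, 0 < a → 0 < b → a + b = 1 →
    φ (a • X + b • Y) ≤ (a : EReal) * φ X + (b : EReal) * φ Y
  mono : ∀ X ∈ S, ∀ Y ∈ S, X ≤ Y → φ X ≤ φ Y

/-- A convex risk function on `S`: a monotone convex function that is cash-additive. -/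
structure IsConvexRiskFunctionOn {P : Measure Ω} (S : Set (L0 P)) (φ : L0 P → EReal) : Prop
    extends IsMonotoneConvexOn S φ where
  cash_additive : ∀ X ∈ S, ∀ c : ℝ, X + AEEqFun.const Ω c ∈ S ∧
    φ (X + AEEqFun.const Ω c) = φ X + (c : EReal)

/-- The Lebesgue property of `φ` on `S`: continuity along sequences of `S` that converge a.s.
and are dominated by an element of `S`. -/
def HasLebesgueProperty {P : Measure Ω} (S : Set (L0 P)) (φ : L0 P → EReal) : Prop :=
  ∀ (X : ℕ → L0 P) (X' : L0 P), (∀ n, X n ∈ S) →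
    (∃ Y ∈ S, 0 ≤ Y ∧ ∀ n, |X n| ≤ Y) →
    (∀ᵐ ω ∂P, Tendsto (fun n => X n ω) atTop (𝓝 (X' ω))) →
    Tendsto (fun n => φ (X n)) atTop (𝓝 (φ X'))

/-- The conjugate `φ*(Z) = sup_{X ∈ L^∞} (E[XZ] - φ(X))`, `Z ∈ L¹`. -/
def conjugate {P : Measure Ω} (φ : L0 P → EReal) (Z : Lp ℝ 1 P) : EReal :=
  ⨆ X ∈ Linf P, (((∫ ω, X ω * Z ω ∂P : ℝ) : EReal) - φ X)

/-- The density `dQ/dP` as an element of `L¹(P)`; used for `Q ≪ P`. -/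
def density (P : Measure Ω) (Q : ProbabilityMeasure Ω) : Lp ℝ 1 P :=
  Integrable.toL1 (fun ω => ((Q : Measure Ω).rnDeriv P ω).toReal)
    Measure.integrable_toReal_rnDeriv

/-- The probabilities `Q ≪ P` whose density lies in the effective domain of the conjugate. -/
def domQ {P : Measure Ω} (φ : L0 P → EReal) : Set (ProbabilityMeasure Ω) :=
  {Q | (Q : Measure Ω) ≪ P ∧ conjugate φ (density P Q) < ⊤}

/-- The expectation `E_Q[X] = E_Q[X⁺] - E_Q[X⁻]` with values in `[-∞, ∞]`. It is meaningful (and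
different from `-∞`) when `X⁻` is `Q`-integrable and is used only then. -/
def expect {P : Measure Ω} (Q : ProbabilityMeasure Ω) (X : L0 P) : EReal :=
  ((∫⁻ ω, ENNReal.ofReal (X ω) ∂(Q : Measure Ω) : ℝ≥0∞) : EReal) -
    ((∫⁻ ω, ENNReal.ofReal (-X ω) ∂(Q : Measure Ω) : ℝ≥0∞) : EReal)

/-- The cone of all `X ∈ L⁰` such that `X⁻ ∈ L¹(Q)` for all `Q ∈ domQ φ`. -/
def coneD {P : Measure Ω} (φ : L0 P → EReal) : Set (L0 P) :=
  {X | ∀ Q ∈ domQ φ, Integrable (fun ω => max (-X ω) 0) (Q : Measure Ω)}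

/-- `φ̂(X) = sup_Q (E_Q[X] - φ*(Q))`, the supremum over `Q ∈ domQ φ`; meaningful on `coneD φ`. -/
def hat {P : Measure Ω} (φ : L0 P → EReal) (X : L0 P) : EReal :=
  ⨆ Q ∈ domQ φ, (expect Q X - conjugate φ (density P Q))

/-- The random variable `α |X| 1_{|X| > N}`. -/
def tail {P : Measure Ω} (α : ℝ) (N : ℕ) (X : L0 P) : L0 P :=
  AEEqFun.compMeasurable ({x : ℝ | (N : ℝ) < |x|}.indicator fun x => α * |x|)
    ((measurable_id.abs.const_mul α).indicator
      (measurableSet_lt measurable_const measurable_id.abs)) X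

/-- The space of all `X` with `lim_N φ̂(α |X| 1_{|X| > N}) = 0` for every `α > 0`. -/
def spaceMu {P : Measure Ω} (φ : L0 P → EReal) : Set (L0 P) :=
  {X | ∀ α : ℝ, 0 < α → Tendsto (fun N : ℕ => hat φ (tail α N X)) atTop (𝓝 0)}

end RiskFunction

end

/-! The Lebesgue property on `L^∞` makes the convex duality exact there: a subgradient of `φ₀` at a
bounded `X` is a positive normalized functional, the Lebesgue property makes it σ-additive, and so
it is integration against a probability `Q ≪ P` attaining the supremum in `φ₀(X) = max_Q (E_Q[X] -
φ₀*(Q))` (`exists_supporting_measure`, `exists_eq_integral_sub_penalty`). Hence `φ̂ = φ₀` on `L^∞`,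
and `X = 0` yields some `Q₀` with zero penalty.

Membership in `M_u` amounts to tail estimates `α E_Q[(|X| - c)⁺] ≤ ε + φ₀*(Q)`, uniform in `Q`
(`mem_spaceMu_iff`). From these the solid space structure and the finiteness of `φ̂` follow
directly. They also control `φ̂` below a dominating `Y ∈ M_u` (`exists_toReal_hat_le_add`): a
moderate `α` shows that measures with large penalty are irrelevant for the supremum, and a large `α`
makes `Y` uniformly integrable over the remaining ones. So truncation at a high level changes
`φ̂(X)` little, uniformly over `|X| ≤ |Y|`, and the Lebesgue property passes from `φ₀` to `φ̂`.

For maximality, let `ψ` be any Lebesgue extension and `X` in its domain. The tails `α(|X| - n)⁺`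
decrease to `0` below `α|X|`, so `ψ` of them tends to `0`; monotonicity and duality on bounded
truncations turn this into the tail estimates, so `X ∈ M_u`. Finally `ψ` and `φ̂` agree on
truncations of `X`, and both are continuous along them. -/

namespace RiskFunction

/-! ### Subgradients of convex functions -/

/-- A real convex function on a vector space has a subgradient at every point. -/
theorem exists_subgradient {E : Type*} [AddCommGroup E] [Module ℝ E] {p : E → ℝ}
    (hp : ConvexOn ℝ Set.univ p) (x : E) :
    ∃ g : E →ₗ[ℝ] ℝ, ∀ y, p x + g y ≤ p (x + y) := by
  let S : E → Set ℝ := fun y => (fun t : ℝ => (p (x + t • y) - p x) / t) '' Set.Ioi 0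
  have hne : ∀ y, (S y).Nonempty := fun y => ⟨_, ⟨1, Set.mem_Ioi.2 one_pos, rfl⟩⟩
  -- `x` is a convex combination of `x + t • y` and `x - y`, so the backward difference bounds every
  -- forward quotient from below.
  have hbdd : ∀ y, BddBelow (S y) := by
    intro y
    refine ⟨p x - p (x - y), ?_⟩
    rintro _ ⟨t, ht, rfl⟩
    have ht' : (0 : ℝ) < t := ht
    have h1 : (0 : ℝ) < 1 + t := by linarith
    have h := hp.2 (Set.mem_univ (x + t • y)) (Set.mem_univ (x - y))
      (show (0 : ℝ) ≤ 1 / (1 + t) by positivity) (show (0 : ℝ) ≤ t / (1 + t) by positivity)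
      (by field_simp)
    have e : (1 / (1 + t)) • (x + t • y) + (t / (1 + t)) • (x - y) = x := by
      match_scalars <;> field_simp <;> ring
    rw [e, smul_eq_mul, smul_eq_mul] at h
    simp only
    rw [le_div_iff₀ ht']
    have h2 : p x * (1 + t) ≤ p (x + t • y) + t * p (x - y) := by
      calc p x * (1 + t) ≤ (1 / (1 + t) * p (x + t • y) + t / (1 + t) * p (x - y)) * (1 + t) := by
            gcongr
        _ = _ := by field_simp
    linarith
  -- `N` is the one-sided directional derivative at `x`, written as an infimum so that no limit is
  -- needed. It is sublinear, and a linear minorant from Hahn–Banach is the subgradient.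
  let N : E → ℝ := fun y => sInf (S y)
  have hNle : ∀ y, ∀ t : ℝ, 0 < t → N y ≤ (p (x + t • y) - p x) / t := fun y t ht =>
    csInf_le (hbdd y) ⟨t, ht, rfl⟩
  have hNsmul : ∀ c : ℝ, 0 < c → ∀ y, c * N y ≤ N (c • y) := by
    intro c hc y
    refine le_csInf (hne _) ?_
    rintro _ ⟨t, ht, rfl⟩
    have ht' : (0 : ℝ) < t := ht
    have h := hNle y (t * c) (by positivity)
    simp only [smul_smul]
    calc c * N y ≤ c * ((p (x + (t * c) • y) - p x) / (t * c)) := by gcongr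
      _ = _ := by field_simp
  have hNhom : ∀ c : ℝ, 0 < c → ∀ y, N (c • y) = c * N y := by
    intro c hc y
    refine le_antisymm ?_ (hNsmul c hc y)
    have h := hNsmul c⁻¹ (inv_pos.2 hc) (c • y)
    rw [inv_smul_smul₀ hc.ne'] at h
    rwa [inv_mul_le_iff₀ hc] at h
  have hNadd : ∀ y z, N (y + z) ≤ N y + N z := by
    intro y z
    -- The weights `t / (s + t)` and `s / (s + t)` give `y` and `z` the same coefficient. As `s` and
    -- `t` are independent, the two infima can then be taken separately.
    have key : ∀ s t : ℝ, 0 < s → 0 < t →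
        N (y + z) ≤ (p (x + s • y) - p x) / s + (p (x + t • z) - p x) / t := by
      intro s t hs ht
      have h1 : 0 < s + t := by positivity
      have h := hp.2 (Set.mem_univ (x + s • y)) (Set.mem_univ (x + t • z))
        (show (0 : ℝ) ≤ t / (s + t) by positivity) (show (0 : ℝ) ≤ s / (s + t) by positivity)
        (by field_simp; ring)
      have e : (t / (s + t)) • (x + s • y) + (s / (s + t)) • (x + t • z)
          = x + (s * t / (s + t)) • (y + z) := by
        match_scalars <;> field_simp <;> ring
      rw [e, smul_eq_mul, smul_eq_mul] at h
      refine (hNle (y + z) (s * t / (s + t)) (by positivity)).trans ?_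
      rw [div_le_iff₀ (by positivity)]
      calc p (x + (s * t / (s + t)) • (y + z)) - p x
          ≤ t / (s + t) * p (x + s • y) + s / (s + t) * p (x + t • z) - p x := by linarith
        _ = _ := by field_simp; ring
    rw [← sub_le_iff_le_add]
    refine le_csInf (hne y) ?_
    rintro _ ⟨s, hs, rfl⟩
    rw [sub_le_comm]
    refine le_csInf (hne z) ?_
    rintro _ ⟨t, ht, rfl⟩
    have := key s t hs ht
    simp only
    linarith
  obtain ⟨g, -, hg⟩ := exists_extension_of_le_sublinear (⊥ : E →ₗ.[ℝ] ℝ) N hNhom hNadd (by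
    rintro ⟨y, hy⟩
    have hy0 : y = 0 := (Submodule.mem_bot ℝ).1 hy
    subst hy0
    have h0 : N 0 = 0 := by
      have := hNhom 2 two_pos 0
      rw [smul_zero] at this
      linarith
    have : (⊥ : E →ₗ.[ℝ] ℝ) ⟨0, hy⟩ = 0 := LinearPMap.map_zero _
    rw [this, h0])
  refine ⟨g, fun y => ?_⟩
  have h := (hg y).trans (hNle y 1 one_pos)
  simp only [one_smul, div_one] at h
  linarith

/-! ### Linear functionals represented by probability measures -/

variable {Ω : Type*} [MeasurableSpace Ω] {P : Measure Ω}

/-- The class of the indicator function of a measurable set. -/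
noncomputable def ind (P : Measure Ω) {s : Set Ω} (hs : MeasurableSet s) : L0 P :=
  AEEqFun.mk (s.indicator fun _ => (1 : ℝ))
    (measurable_const.indicator hs).aestronglyMeasurable

theorem mem_Linf_of_bound {X : L0 P} (C : ℝ) (h : ∀ᵐ ω ∂P, |X ω| ≤ C) : X ∈ Linf P := by
  have h1 : MemLp X ∞ P := memLp_top_of_bound X.aestronglyMeasurable C (by simpa using h)
  exact Lp.mem_Lp_iff_memLp.2 h1

theorem exists_bound_of_mem_Linf {X : L0 P} (h : X ∈ Linf P) :
    ∃ C : ℝ, 0 ≤ C ∧ ∀ᵐ ω ∂P, |X ω| ≤ C := by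
  have h1 : MemLp X ∞ P := Lp.mem_Lp_iff_memLp.1 h
  have h2 : eLpNormEssSup X P < ∞ := by simpa using h1.2
  refine ⟨(eLpNormEssSup X P).toReal, ENNReal.toReal_nonneg, ?_⟩
  filter_upwards [ae_le_eLpNormEssSup (f := X) (μ := P)] with ω hω
  have := ENNReal.toReal_mono h2.ne hω
  simpa using this

/-- A positive normalized linear functional that is continuous along bounded a.s. convergent
sequences is the expectation under a probability measure. -/
theorem exists_probabilityMeasure_of_linear (L : L0 P →ₗ[ℝ] ℝ)
    (hpos : ∀ Y ∈ Linf P, 0 ≤ Y → 0 ≤ L Y) (hone : L (AEEqFun.const Ω 1) = 1)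
    (hcont : ∀ (Y : ℕ → L0 P) (Y' : L0 P) (C : ℝ), (∀ n, ∀ᵐ ω ∂P, |Y n ω| ≤ C) →
      (∀ᵐ ω ∂P, Tendsto (fun n => Y n ω) atTop (𝓝 (Y' ω))) →
      Tendsto (fun n => L (Y n)) atTop (𝓝 (L Y'))) :
    ∃ Q : ProbabilityMeasure Ω, (Q : Measure Ω) ≪ P ∧
      ∀ Y ∈ Linf P, L Y = ∫ ω, Y ω ∂(Q : Measure Ω) := by
  have hind : ∀ {s : Set Ω} (hs : MeasurableSet s),
      ∀ᵐ ω ∂P, ind P hs ω = s.indicator (fun _ => (1 : ℝ)) ω := fun hs => AEEqFun.coeFn_mk _ _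
  have hindpos : ∀ {s : Set Ω} (hs : MeasurableSet s), 0 ≤ L (ind P hs) := by
    intro s hs
    refine hpos _ (mem_Linf_of_bound 1 ?_) ?_
    · filter_upwards [hind hs] with ω hω
      rw [hω]
      by_cases h : ω ∈ s <;> simp [h]
    · rw [← AEEqFun.coeFn_le]
      filter_upwards [hind hs, AEEqFun.coeFn_zero (μ := P) (β := ℝ)] with ω hω h0
      rw [hω, h0]
      exact Set.indicator_nonneg (fun _ _ => zero_le_one) _
  have hempty : L (ind P MeasurableSet.empty) = 0 := by
    have : ind P (MeasurableSet.empty (α := Ω)) = 0 := by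
      apply AEEqFun.ext
      filter_upwards [hind (MeasurableSet.empty (α := Ω)),
        AEEqFun.coeFn_zero (μ := P) (β := ℝ)] with ω hω h0
      rw [hω, h0]; simp
    rw [this, map_zero]
  have hsum : ∀ ⦃f : ℕ → Set Ω⦄ (h : ∀ i, MeasurableSet (f i)),
      Pairwise (Function.onFun Disjoint f) →
      HasSum (fun i => L (ind P (h i))) (L (ind P (MeasurableSet.iUnion h))) := by
    intro f h hd
    rw [hasSum_iff_tendsto_nat_of_nonneg fun i => hindpos (h i)]
    have hsm : ∀ n, ∀ᵐ ω ∂P, (∑ i ∈ Finset.range n, ind P (h i) : L0 P) ω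
        = ∑ i ∈ Finset.range n, (f i).indicator (fun _ => (1 : ℝ)) ω := by
      intro n
      filter_upwards [AEEqFun.coeFn_finsetSum (Finset.range n) (fun i => ind P (h i)),
        ae_all_iff.2 fun i => hind (h i)] with ω h1 h2
      rw [h1, Finset.sum_apply]
      exact Finset.sum_congr rfl fun i _ => h2 i
    simp_rw [← map_sum]
    -- By disjointness the partial sums are indicators themselves, hence bounded by `1`.
    refine hcont _ _ 1 (fun n => ?_) ?_
    · filter_upwards [hsm n] with ω hω
      rw [hω, ← Finset.indicator_biUnion_apply _ _ (fun i _ j _ hij => hd hij)]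
      by_cases h : ω ∈ ⋃ i ∈ Finset.range n, f i <;>
        simp only [h, Set.indicator_of_mem, Set.indicator_of_notMem, not_false_eq_true] <;> simp
    · filter_upwards [ae_all_iff.2 hsm, hind (MeasurableSet.iUnion h)] with ω h1 h2
      simp_rw [h1, h2]
      refine HasSum.tendsto_sum_nat ?_
      by_cases hm : ω ∈ ⋃ i, f i
      · obtain ⟨j, hj⟩ := Set.mem_iUnion.1 hm
        have e : (⋃ i, f i).indicator (fun _ => (1 : ℝ)) ω
            = (f j).indicator (fun _ => (1 : ℝ)) ω := by simp [hm, hj]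
        rw [e]
        refine hasSum_single j fun i hij => ?_
        refine Set.indicator_of_notMem (fun hi => ?_) _
        exact Set.disjoint_left.1 (hd hij) hi hj
      · rw [Set.indicator_of_notMem hm]
        have : ∀ i, (f i).indicator (fun _ => (1 : ℝ)) ω = 0 := fun i =>
          Set.indicator_of_notMem (fun hi => hm (Set.mem_iUnion.2 ⟨i, hi⟩)) _
        simp_rw [this]
        exact hasSum_zero
  let Q : Measure Ω := Measure.ofMeasurable (fun s hs => ENNReal.ofReal (L (ind P hs)))
    (by simp [hempty]) (by
      intro f h hd
      have hs := hsum h hd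
      rw [← hs.tsum_eq, ENNReal.ofReal_tsum_of_nonneg (fun i => hindpos (h i)) hs.summable])
  have hQ : ∀ {s : Set Ω} (hs : MeasurableSet s), Q s = ENNReal.ofReal (L (ind P hs)) :=
    fun hs => Measure.ofMeasurable_apply _ hs
  have huniv : L (ind P MeasurableSet.univ) = 1 := by
    rw [← hone]
    congr 1
    apply AEEqFun.ext
    filter_upwards [hind (MeasurableSet.univ (α := Ω)),
      AEEqFun.coeFn_const (μ := P) (α := Ω) (1 : ℝ)] with ω hω h0
    rw [hω, h0]; simp
  have hprob : IsProbabilityMeasure Q := ⟨by rw [hQ MeasurableSet.univ, huniv]; simp⟩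
  have hac : Q ≪ P := by
    refine Measure.AbsolutelyContinuous.mk fun s hs h0 => ?_
    have : ind P hs = 0 := by
      apply AEEqFun.ext
      filter_upwards [hind hs, AEEqFun.coeFn_zero (μ := P) (β := ℝ),
        measure_eq_zero_iff_ae_notMem.1 h0] with ω hω h0 hn
      rw [hω, h0]; simp [hn]
    rw [hQ hs, this, map_zero, ENNReal.ofReal_zero]
  refine ⟨⟨Q, hprob⟩, hac, fun Y hY => ?_⟩
  change L Y = ∫ ω, Y ω ∂Q
  have hsimple : ∀ f : SimpleFunc Ω ℝ,
      L (AEEqFun.mk f f.aestronglyMeasurable) = ∫ ω, f ω ∂Q := by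
    intro f
    induction f using SimpleFunc.induction with
    | const c hs =>
      rename_i s
      have e : ∀ ω, (SimpleFunc.piecewise s hs (SimpleFunc.const Ω c) (SimpleFunc.const Ω 0)) ω
          = s.indicator (fun _ => c) ω := by
        intro ω; by_cases h : ω ∈ s <;> simp [h]
      have e2 : (AEEqFun.mk (SimpleFunc.piecewise s hs (SimpleFunc.const Ω c)
          (SimpleFunc.const Ω 0)) (SimpleFunc.aestronglyMeasurable _) : L0 P)
          = c • ind P hs := by
        apply AEEqFun.ext
        filter_upwards [hind hs, AEEqFun.coeFn_smul c (ind P hs), AEEqFun.coeFn_mk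
          (SimpleFunc.piecewise s hs (SimpleFunc.const Ω c) (SimpleFunc.const Ω 0))
          (SimpleFunc.aestronglyMeasurable (μ := P) _)] with ω h1 h2 h3
        rw [h3, h2, Pi.smul_apply, h1, e]
        by_cases h : ω ∈ s <;> simp [h]
      rw [e2, map_smul]
      simp_rw [e]
      rw [integral_indicator_const c hs, Measure.real, hQ hs,
        ENNReal.toReal_ofReal (hindpos hs), smul_eq_mul, smul_eq_mul, mul_comm]
    | add hfg hf hg =>
      rename_i f g
      have e2 : (AEEqFun.mk (f + g : SimpleFunc Ω ℝ) (SimpleFunc.aestronglyMeasurable _) : L0 P)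
          = AEEqFun.mk f f.aestronglyMeasurable + AEEqFun.mk g g.aestronglyMeasurable := rfl
      rw [e2, map_add, hf, hg, SimpleFunc.coe_add]
      simp_rw [Pi.add_apply]
      rw [integral_add (SimpleFunc.integrable_of_isFiniteMeasure _)
        (SimpleFunc.integrable_of_isFiniteMeasure _)]
  -- Simple functions bounded by `C` converge a.s. to `Y`; `L` and the integral both pass to the
  -- limit along them.
  obtain ⟨C, hC, hb⟩ := exists_bound_of_mem_Linf hY
  have hsY := Y.stronglyMeasurable
  have hb' : ∀ᵐ ω ∂P, ‖Y ω‖ ≤ C := by simpa using hb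
  have ht := hsY.tendsto_approxBounded_ae (c := C) hb'
  have hb2 : ∀ n ω, ‖hsY.approxBounded C n ω‖ ≤ C := hsY.norm_approxBounded_le hC
  have t1 : Tendsto (fun n => L (AEEqFun.mk (hsY.approxBounded C n)
      (SimpleFunc.aestronglyMeasurable _))) atTop (𝓝 (L Y)) := by
    refine hcont _ _ C (fun n => ?_) ?_
    · filter_upwards [AEEqFun.coeFn_mk (hsY.approxBounded C n)
        (SimpleFunc.aestronglyMeasurable (μ := P) _)] with ω hω
      rw [hω]; exact hb2 n ω
    · filter_upwards [ht, ae_all_iff.2 fun n => AEEqFun.coeFn_mk (hsY.approxBounded C n)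
        (SimpleFunc.aestronglyMeasurable (μ := P) _)] with ω hω h2
      simp_rw [h2]
      exact hω
  simp_rw [hsimple] at t1
  refine tendsto_nhds_unique t1 (tendsto_integral_of_dominated_convergence (fun _ => C)
    (fun n => SimpleFunc.aestronglyMeasurable _) (integrable_const C)
    (fun n => Eventually.of_forall (hb2 n)) (hac.ae_le ht))

/-! ### Convex risk functions on bounded random variables -/

theorem const_mem_Linf (c : ℝ) : AEEqFun.const Ω c ∈ Linf P := by
  refine mem_Linf_of_bound |c| ?_
  filter_upwards [AEEqFun.coeFn_const (μ := P) (α := Ω) c] with ω h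
  rw [h]; rfl

theorem zero_mem_Linf : (0 : L0 P) ∈ Linf P := (Lp.LpSubmodule ℝ ℝ ∞ P).zero_mem

theorem add_mem_Linf {X Y : L0 P} (hX : X ∈ Linf P) (hY : Y ∈ Linf P) : X + Y ∈ Linf P :=
  (Lp.LpSubmodule ℝ ℝ ∞ P).add_mem hX hY

theorem neg_mem_Linf {X : L0 P} (hX : X ∈ Linf P) : -X ∈ Linf P :=
  (Lp.LpSubmodule ℝ ℝ ∞ P).neg_mem hX

theorem smul_mem_Linf (c : ℝ) {X : L0 P} (hX : X ∈ Linf P) : c • X ∈ Linf P :=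
  (Lp.LpSubmodule ℝ ℝ ∞ P).smul_mem c hX

section
variable {φ : L0 P → EReal} (hφ : IsConvexRiskFunctionOn (Linf P) φ) (h0 : φ 0 = 0)
include hφ h0

theorem IsConvexRiskFunctionOn.const (c : ℝ) : φ (AEEqFun.const Ω c) = c := by
  have := (hφ.cash_additive 0 zero_mem_Linf c).2
  rwa [zero_add, h0, zero_add] at this

theorem IsConvexRiskFunctionOn.ne_top {X : L0 P} (hX : X ∈ Linf P) : φ X ≠ ⊤ := by
  obtain ⟨C, -, hC⟩ := exists_bound_of_mem_Linf hX
  have h1 : φ X ≤ φ (AEEqFun.const Ω C) := by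
    refine hφ.mono _ hX _ (const_mem_Linf C) ?_
    rw [← AEEqFun.coeFn_le]
    filter_upwards [hC, AEEqFun.coeFn_const (μ := P) (α := Ω) C] with ω h1 h2
    rw [h2]; exact (le_abs_self _).trans h1
  rw [hφ.const h0] at h1
  exact ne_top_of_le_ne_top (EReal.coe_ne_top C) h1

theorem IsConvexRiskFunctionOn.coe_toReal {X : L0 P} (hX : X ∈ Linf P) :
    ((φ X).toReal : EReal) = φ X :=
  EReal.coe_toReal (hφ.ne_top h0 hX) (hφ.ne_bot X hX)

theorem IsConvexRiskFunctionOn.convexOn_toReal :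
    ConvexOn ℝ Set.univ (fun v : Lp.LpSubmodule ℝ ℝ ∞ P => (φ (v : L0 P)).toReal) := by
  refine convexOn_iff_forall_pos.2 ⟨convex_univ, ?_⟩
  rintro ⟨X, hX⟩ - ⟨Y, hY⟩ - a b ha hb hab
  have h := hφ.convex X hX Y hY a b ha hb hab
  rw [← hφ.coe_toReal h0 hX, ← hφ.coe_toReal h0 hY,
    ← hφ.coe_toReal h0 (add_mem_Linf (smul_mem_Linf a hX) (smul_mem_Linf b hY))] at h
  exact_mod_cast h

/-- Bounded random variables have supporting probability measures. -/
theorem exists_supporting_measure (hL : HasLebesgueProperty (Linf P) φ) {X : L0 P}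
    (hX : X ∈ Linf P) :
    ∃ Q : ProbabilityMeasure Ω, (Q : Measure Ω) ≪ P ∧ ∀ Y ∈ Linf P,
      ∫ ω, Y ω ∂(Q : Measure Ω) - (φ Y).toReal ≤ ∫ ω, X ω ∂(Q : Measure Ω) - (φ X).toReal := by
  obtain ⟨g, hg⟩ := exists_subgradient (hφ.convexOn_toReal h0) ⟨X, hX⟩
  -- An arbitrary linear extension to `L⁰`: only the values of `L` on `Linf P` matter.
  obtain ⟨L, hLg⟩ := LinearMap.exists_extend g
  have hsub : ∀ Y ∈ Linf P, (φ X).toReal + L Y ≤ (φ (X + Y)).toReal := by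
    intro Y hY
    have h1 := hg ⟨Y, hY⟩
    have h2 : L Y = g ⟨Y, hY⟩ := by rw [← hLg]; rfl
    rw [h2]; exact h1
  have hpos : ∀ Y ∈ Linf P, 0 ≤ Y → 0 ≤ L Y := by
    intro Y hY hY0
    have h1 := hsub (-Y) (neg_mem_Linf hY)
    have h2 : φ (X + -Y) ≤ φ X := by
      refine hφ.mono _ (add_mem_Linf hX (neg_mem_Linf hY)) _ hX ?_
      rw [← AEEqFun.coeFn_le] at hY0 ⊢
      filter_upwards [hY0, AEEqFun.coeFn_add X (-Y), AEEqFun.coeFn_neg Y,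
        AEEqFun.coeFn_zero (μ := P) (β := ℝ)] with ω h1 h2 h3 h4
      rw [h4] at h1
      rw [h2, Pi.add_apply, h3]
      simp only [Pi.neg_apply, Pi.zero_apply] at *
      linarith
    have h3 := EReal.toReal_le_toReal h2
      (hφ.ne_bot _ (add_mem_Linf hX (neg_mem_Linf hY))) (hφ.ne_top h0 hX)
    rw [map_neg] at h1
    linarith
  have hcash : ∀ c : ℝ, L (AEEqFun.const Ω c) ≤ c := by
    intro c
    have h1 := hsub _ (const_mem_Linf c)
    rw [(hφ.cash_additive X hX c).2, EReal.toReal_add (hφ.ne_top h0 hX) (hφ.ne_bot _ hX)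
      (EReal.coe_ne_top c) (EReal.coe_ne_bot c), EReal.toReal_coe] at h1
    linarith
  have hone : L (AEEqFun.const Ω 1) = 1 := by
    refine le_antisymm (hcash 1) ?_
    have h1 := hcash (-1)
    have h2 : (AEEqFun.const Ω (-1 : ℝ) : L0 P) = -AEEqFun.const Ω 1 := rfl
    rw [h2, map_neg] at h1
    linarith
  have hcont : ∀ (Y : ℕ → L0 P) (Y' : L0 P) (C : ℝ), (∀ n, ∀ᵐ ω ∂P, |Y n ω| ≤ C) →
      (∀ᵐ ω ∂P, Tendsto (fun n => Y n ω) atTop (𝓝 (Y' ω))) →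
      Tendsto (fun n => L (Y n)) atTop (𝓝 (L Y')) := by
    intro Y Y' C hb ht
    have hb' : ∀ᵐ ω ∂P, |Y' ω| ≤ C := by
      filter_upwards [ae_all_iff.2 hb, ht] with ω h1 h2
      exact le_of_tendsto h2.abs (Eventually.of_forall h1)
    have hYn : ∀ n, Y n ∈ Linf P := fun n => mem_Linf_of_bound C (hb n)
    have hY' : Y' ∈ Linf P := mem_Linf_of_bound C hb'
    obtain ⟨K, hK0, hK⟩ := exists_bound_of_mem_Linf hX
    -- With `D = Y n - Y'`, the subgradient inequality at `±D` squeezes `L D` between `-(φ (X - D) -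
    -- φ X)` and `φ (X + D) - φ X`; the Lebesgue property sends both to `0`.
    have key : ∀ e : ℝ, |e| = 1 →
        Tendsto (fun n => (φ (X + e • (Y n - Y'))).toReal - (φ X).toReal) atTop (𝓝 0) := by
      intro e he
      have hco : ∀ n, ∀ᵐ ω ∂P, (X + e • (Y n - Y')) ω = X ω + e * (Y n ω - Y' ω) := by
        intro n
        filter_upwards [AEEqFun.coeFn_add X (e • (Y n - Y')), AEEqFun.coeFn_smul e (Y n - Y'),
          AEEqFun.coeFn_sub (Y n) Y'] with ω h1 h2 h3
        rw [h1, Pi.add_apply, h2, Pi.smul_apply, h3, Pi.sub_apply, smul_eq_mul]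
      have h1 : Tendsto (fun n => φ (X + e • (Y n - Y'))) atTop (𝓝 (φ X)) := by
        refine hL _ _ (fun n => ?_) ⟨AEEqFun.const Ω (K + 2 * |C|), const_mem_Linf _, ?_, ?_⟩ ?_
        · exact add_mem_Linf hX (smul_mem_Linf _ (by
            rw [sub_eq_add_neg]; exact add_mem_Linf (hYn n) (neg_mem_Linf hY')))
        · rw [← AEEqFun.coeFn_le]
          filter_upwards [AEEqFun.coeFn_zero (μ := P) (β := ℝ),
            AEEqFun.coeFn_const (μ := P) (α := Ω) (K + 2 * |C|)] with ω h1 h2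
          rw [h1, h2]
          simp only [Pi.zero_apply, Function.const_apply]
          positivity
        · intro n
          rw [← AEEqFun.coeFn_le]
          filter_upwards [AEEqFun.coeFn_abs (X + e • (Y n - Y')), hco n, hb n, hb', hK,
            AEEqFun.coeFn_const (μ := P) (α := Ω) (K + 2 * |C|)] with ω h1 h2 h3 h4 h5 h6
          rw [h1, h2, h6]
          simp only [Function.const_apply]
          calc |X ω + e * (Y n ω - Y' ω)| ≤ |X ω| + |e * (Y n ω - Y' ω)| := abs_add_le _ _
            _ = |X ω| + |Y n ω - Y' ω| := by rw [abs_mul, he, one_mul]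
            _ ≤ |X ω| + (|Y n ω| + |Y' ω|) := by gcongr; exact abs_sub _ _
            _ ≤ _ := by linarith [le_abs_self C]
        · filter_upwards [ae_all_iff.2 hco, ht] with ω h1 h2
          simp_rw [h1]
          have := ((h2.sub_const (Y' ω)).const_mul e).const_add (X ω)
          simpa using this
      have h2 := (EReal.tendsto_toReal (hφ.ne_top h0 hX) (hφ.ne_bot _ hX)).comp h1
      simpa using h2.sub_const (φ X).toReal
    have hD : ∀ n, Y n - Y' ∈ Linf P := fun n => by
      rw [sub_eq_add_neg]; exact add_mem_Linf (hYn n) (neg_mem_Linf hY')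
    have hlim : Tendsto (fun n => L (Y n - Y')) atTop (𝓝 0) := by
      have k1 := (key (-1) (by simp)).neg
      rw [neg_zero] at k1
      refine tendsto_of_tendsto_of_tendsto_of_le_of_le k1 (key 1 (by simp)) (fun n => ?_)
        (fun n => ?_)
      · have := hsub ((-1 : ℝ) • (Y n - Y')) (smul_mem_Linf _ (hD n))
        rw [map_smul, smul_eq_mul] at this
        simp only
        linarith
      · have := hsub ((1 : ℝ) • (Y n - Y')) (smul_mem_Linf _ (hD n))
        rw [map_smul, smul_eq_mul] at this
        simp only
        linarith
    simpa using hlim.add_const (L Y')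
  obtain ⟨Q, hQP, hQ⟩ := exists_probabilityMeasure_of_linear L hpos hone hcont
  refine ⟨Q, hQP, fun Y hY => ?_⟩
  rw [← hQ Y hY, ← hQ X hX]
  have h1 := hsub (Y - X) (by rw [sub_eq_add_neg]; exact add_mem_Linf hY (neg_mem_Linf hX))
  rw [add_sub_cancel, map_sub] at h1
  linarith
end

/-! ### Duality with the penalty -/

theorem conjugate_density (φ : L0 P → EReal) [SigmaFinite P] {Q : ProbabilityMeasure Ω}
    (hQ : (Q : Measure Ω) ≪ P) :
    conjugate φ (density P Q) =
      ⨆ X ∈ Linf P, (((∫ ω, X ω ∂(Q : Measure Ω) : ℝ) : EReal) - φ X) := by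
  unfold conjugate
  have : ∀ X : L0 P, ∫ ω, X ω * density P Q ω ∂P = ∫ ω, X ω ∂(Q : Measure Ω) := by
    intro X
    rw [← integral_rnDeriv_smul hQ]
    refine integral_congr_ae ?_
    filter_upwards [Integrable.coeFn_toL1 (f := fun ω => ((Q : Measure Ω).rnDeriv P ω).toReal)
      (μ := P) Measure.integrable_toReal_rnDeriv] with ω h
    rw [density, h, smul_eq_mul, mul_comm]
  simp_rw [this]

/-- The real-valued penalty `φ*(Q)`; it is meaningful on `domQ φ`. -/
noncomputable def penalty (φ : L0 P → EReal) (Q : ProbabilityMeasure Ω) : ℝ :=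
  (conjugate φ (density P Q)).toReal

section
variable {φ : L0 P → EReal} (h0 : φ 0 = 0)
include h0

theorem conjugate_nonneg (Z : Lp ℝ 1 P) : 0 ≤ conjugate φ Z := by
  refine le_trans (le_of_eq ?_) (le_iSup₂ (0 : L0 P) zero_mem_Linf)
  rw [h0]
  have : ∫ ω, (0 : L0 P) ω * Z ω ∂P = 0 := by
    rw [integral_eq_zero_of_ae]
    filter_upwards [AEEqFun.coeFn_zero (μ := P) (β := ℝ)] with ω h
    rw [h]; simp
  rw [this]; simp

theorem coe_penalty {Q : ProbabilityMeasure Ω} (hQ : Q ∈ domQ φ) :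
    conjugate φ (density P Q) = penalty φ Q :=
  (EReal.coe_toReal hQ.2.ne
    (ne_bot_of_le_ne_bot (by simp) (conjugate_nonneg h0 _))).symm

theorem penalty_nonneg (Q : ProbabilityMeasure Ω) : 0 ≤ penalty φ Q :=
  EReal.toReal_nonneg (conjugate_nonneg h0 _)

variable [IsProbabilityMeasure P] (hφ : IsConvexRiskFunctionOn (Linf P) φ)
include hφ

theorem integral_sub_penalty_le {Q : ProbabilityMeasure Ω} (hQ : Q ∈ domQ φ) {X : L0 P}
    (hX : X ∈ Linf P) : ∫ ω, X ω ∂(Q : Measure Ω) - penalty φ Q ≤ (φ X).toReal := by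
  have h1 : ((∫ ω, X ω ∂(Q : Measure Ω) : ℝ) : EReal) - φ X ≤ penalty φ Q := by
    rw [← coe_penalty h0 hQ, conjugate_density φ hQ.1]
    exact le_iSup₂ (f := fun (X : L0 P) (_ : X ∈ Linf P) =>
      ((∫ ω, X ω ∂(Q : Measure Ω) : ℝ) : EReal) - φ X) X hX
  rw [← hφ.coe_toReal h0 hX] at h1
  have h2 : ∫ ω, X ω ∂(Q : Measure Ω) - (φ X).toReal ≤ penalty φ Q := by exact_mod_cast h1
  linarith

/-- The supporting measure at `X` gives equality in Fenchel's inequality, so the dual supremum is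
attained. -/
theorem exists_eq_integral_sub_penalty (hL : HasLebesgueProperty (Linf P) φ) {X : L0 P}
    (hX : X ∈ Linf P) :
    ∃ Q ∈ domQ φ, (φ X).toReal = ∫ ω, X ω ∂(Q : Measure Ω) - penalty φ Q := by
  obtain ⟨Q, hQP, hQ⟩ := exists_supporting_measure hφ h0 hL hX
  have hle : conjugate φ (density P Q) ≤
      ((∫ ω, X ω ∂(Q : Measure Ω) - (φ X).toReal : ℝ) : EReal) := by
    rw [conjugate_density φ hQP]
    refine iSup₂_le fun Y hY => ?_
    rw [← hφ.coe_toReal h0 hY]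
    exact_mod_cast hQ Y hY
  have hdom : Q ∈ domQ φ := ⟨hQP, hle.trans_lt (EReal.coe_lt_top _)⟩
  refine ⟨Q, hdom, le_antisymm ?_ (integral_sub_penalty_le h0 hφ hdom hX)⟩
  rw [coe_penalty h0 hdom] at hle
  have : penalty φ Q ≤ ∫ ω, X ω ∂(Q : Measure Ω) - (φ X).toReal := by exact_mod_cast hle
  linarith

theorem exists_penalty_eq_zero (hL : HasLebesgueProperty (Linf P) φ) :
    ∃ Q ∈ domQ φ, penalty φ Q = 0 := by
  obtain ⟨Q, hQ, h⟩ := exists_eq_integral_sub_penalty h0 hφ hL (zero_mem_Linf (P := P))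
  refine ⟨Q, hQ, ?_⟩
  have : ∫ ω, (0 : L0 P) ω ∂(Q : Measure Ω) = 0 := by
    rw [integral_eq_zero_of_ae]
    filter_upwards [hQ.1.ae_le (AEEqFun.coeFn_zero (μ := P) (β := ℝ))] with ω h
    rw [h]
  rw [h0, this] at h
  simpa using h.symm
end

/-! ### Extended expectations and tails -/

theorem expect_of_nonneg {Q : ProbabilityMeasure Ω} (hQ : (Q : Measure Ω) ≪ P) {X : L0 P}
    (hX : 0 ≤ X) :
    expect Q X = ((∫⁻ ω, ENNReal.ofReal (X ω) ∂(Q : Measure Ω) : ℝ≥0∞) : EReal) := by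
  have : ∫⁻ ω, ENNReal.ofReal (-X ω) ∂(Q : Measure Ω) = 0 := by
    rw [lintegral_eq_zero_iff' (by
      exact (X.stronglyMeasurable.measurable.neg.ennreal_ofReal).aemeasurable)]
    rw [← AEEqFun.coeFn_le] at hX
    filter_upwards [hQ.ae_le hX, hQ.ae_le (AEEqFun.coeFn_zero (μ := P) (β := ℝ))] with ω h1 h2
    rw [h2] at h1
    simpa using h1
  rw [expect, this]
  simp

theorem expect_of_integrable {Q : ProbabilityMeasure Ω} {X : L0 P}
    (hX : Integrable X (Q : Measure Ω)) :
    expect Q X = ((∫ ω, X ω ∂(Q : Measure Ω) : ℝ) : EReal) := by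
  rw [integral_eq_lintegral_pos_part_sub_lintegral_neg_part hX, EReal.coe_sub, expect,
    EReal.coe_ennreal_toReal, EReal.coe_ennreal_toReal]
  · exact hX.neg.lintegral_lt_top.ne
  · exact hX.lintegral_lt_top.ne

theorem expect_ne_bot {Q : ProbabilityMeasure Ω} {X : L0 P}
    (hX : Integrable (fun ω => max (-X ω) 0) (Q : Measure Ω)) : expect Q X ≠ ⊥ := by
  have h1 : ∫⁻ ω, ENNReal.ofReal (-X ω) ∂(Q : Measure Ω) ≠ ⊤ := by
    have h2 := hX.lintegral_lt_top
    refine ne_top_of_le_ne_top h2.ne (lintegral_mono fun ω => ?_)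
    exact ENNReal.ofReal_le_ofReal (le_max_left _ _)
  rw [expect, ← EReal.coe_ennreal_toReal h1, sub_eq_add_neg]
  rw [Ne, EReal.add_eq_bot_iff, not_or]
  refine ⟨EReal.coe_ennreal_ne_bot _, ?_⟩
  rw [← EReal.coe_neg]
  exact EReal.coe_ne_bot _

theorem mem_coneD_of_nonneg {φ : L0 P → EReal} {X : L0 P} (hX : 0 ≤ X) : X ∈ coneD φ := by
  intro Q hQ
  refine (integrable_zero Ω ℝ (Q : Measure Ω)).congr ?_
  rw [← AEEqFun.coeFn_le] at hX
  filter_upwards [hQ.1.ae_le hX, hQ.1.ae_le (AEEqFun.coeFn_zero (μ := P) (β := ℝ))] with ω h1 h2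
  rw [h2] at h1
  simpa using h1

theorem tail_ae (α : ℝ) (N : ℕ) (X : L0 P) :
    ∀ᵐ ω ∂P, tail α N X ω = if (N : ℝ) < |X ω| then α * |X ω| else 0 := by
  filter_upwards [AEEqFun.coeFn_compMeasurable ({x : ℝ | (N : ℝ) < |x|}.indicator fun x => α * |x|)
    ((measurable_id.abs.const_mul α).indicator
      (measurableSet_lt measurable_const measurable_id.abs)) X] with ω h
  rw [tail, h]
  simp [Set.indicator_apply]

theorem tail_nonneg {α : ℝ} (hα : 0 ≤ α) (N : ℕ) (X : L0 P) : 0 ≤ tail α N X := by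
  rw [← AEEqFun.coeFn_le]
  filter_upwards [tail_ae α N X, AEEqFun.coeFn_zero (μ := P) (β := ℝ)] with ω h1 h2
  rw [h1, h2]
  split_ifs
  · exact mul_nonneg hα (abs_nonneg _)
  · exact le_rfl

/-! ### The space `spaceMu φ` and the extension `hat φ` -/

section
variable {φ : L0 P → EReal} (h0 : φ 0 = 0)
include h0

theorem hat_ne_bot (hne : (domQ φ).Nonempty) {X : L0 P} (hX : X ∈ coneD φ) : hat φ X ≠ ⊥ := by
  obtain ⟨Q, hQ⟩ := hne
  have h1 : expect Q X - conjugate φ (density P Q) ≤ hat φ X :=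
    le_iSup₂ (f := fun Q (_ : Q ∈ domQ φ) => expect Q X - conjugate φ (density P Q)) Q hQ
  refine ne_bot_of_le_ne_bot ?_ h1
  rw [coe_penalty h0 hQ, sub_eq_add_neg, Ne, EReal.add_eq_bot_iff, not_or, ← EReal.coe_neg]
  exact ⟨expect_ne_bot (hX Q hQ), EReal.coe_ne_bot _⟩

theorem hat_nonneg (hz : ∃ Q ∈ domQ φ, penalty φ Q = 0) {X : L0 P} (hX : 0 ≤ X) :
    0 ≤ hat φ X := by
  obtain ⟨Q, hQ, hQ0⟩ := hz
  refine le_trans ?_ (le_iSup₂ (f := fun Q (_ : Q ∈ domQ φ) =>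
    expect Q X - conjugate φ (density P Q)) Q hQ)
  rw [coe_penalty h0 hQ, hQ0, expect_of_nonneg hQ.1 hX]
  simpa using EReal.coe_ennreal_nonneg _

/-- Turns bounds on `hat φ` into bounds on lower integrals, which need no integrability of `X`. -/
theorem hat_le_coe_iff {X : L0 P} (hX : 0 ≤ X) {r : ℝ} (hr : 0 ≤ r) :
    hat φ X ≤ r ↔ ∀ Q ∈ domQ φ,
      ∫⁻ ω, ENNReal.ofReal (X ω) ∂(Q : Measure Ω) ≤ ENNReal.ofReal (r + penalty φ Q) := by
  unfold hat
  rw [iSup₂_le_iff]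
  refine forall₂_congr fun Q hQ => ?_
  have hp := penalty_nonneg h0 Q
  rw [coe_penalty h0 hQ, expect_of_nonneg hQ.1 hX,
    EReal.sub_le_iff_le_add (.inl (EReal.coe_ne_bot _)) (.inl (EReal.coe_ne_top _)),
    ← EReal.coe_add, ← EReal.coe_ennreal_le_coe_ennreal_iff, EReal.coe_ennreal_ofReal,
    max_eq_left (by positivity)]

/-- The cut-off tail `|X| 1_{|X| > N}` and the excess `(|X| - c)⁺` control each other up to a factor
`2` in `α`. The excess behaves better under sums and scaling; `ENNReal.ofReal` supplies its positive
part. -/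
theorem mem_spaceMu_iff (hz : ∃ Q ∈ domQ φ, penalty φ Q = 0) {X : L0 P} :
    X ∈ spaceMu φ ↔ ∀ α : ℝ, 0 < α → ∀ ε : ℝ, 0 < ε → ∃ c : ℝ, 0 ≤ c ∧ ∀ Q ∈ domQ φ,
      ∫⁻ ω, ENNReal.ofReal (α * (|X ω| - c)) ∂(Q : Measure Ω)
        ≤ ENNReal.ofReal (ε + penalty φ Q) := by
  constructor
  · intro hX α hα ε hε
    have hev : ∀ᶠ N : ℕ in atTop, hat φ (tail α N X) < (ε : EReal) :=
      (hX α hα).eventually_lt_const (by exact_mod_cast hε)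
    obtain ⟨N, hN⟩ := hev.exists
    refine ⟨N, Nat.cast_nonneg N, fun Q hQ => ?_⟩
    refine le_trans (lintegral_mono_ae ?_)
      ((hat_le_coe_iff h0 (tail_nonneg hα.le N X) hε.le).1 hN.le Q hQ)
    filter_upwards [hQ.1.ae_le (tail_ae α N X)] with ω h
    rw [h]
    refine ENNReal.ofReal_le_ofReal_iff'.2 ?_
    split_ifs with hc
    · left
      have : (0 : ℝ) ≤ N := Nat.cast_nonneg N
      nlinarith
    · right
      exact mul_nonpos_of_nonneg_of_nonpos hα.le (by linarith)
  · intro h α hα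
    refine tendsto_order.2 ⟨fun a ha => ?_, fun b hb => ?_⟩
    · exact Eventually.of_forall fun N => ha.trans_le (hat_nonneg h0 hz (tail_nonneg hα.le N X))
    · obtain ⟨ε, hε0, hεb⟩ := EReal.lt_iff_exists_real_btwn.1 hb
      have hε : 0 < ε := by exact_mod_cast hε0
      -- Once `2 * c ≤ N`, `|x| > N` implies `|x| ≤ 2 * (|x| - c)`, whence the factor `2` in front
      -- of `α`.
      obtain ⟨c, hc, hcQ⟩ := h (2 * α) (by positivity) ε hε
      filter_upwards [eventually_ge_atTop ⌈2 * c⌉₊] with N hN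
      refine lt_of_le_of_lt ?_ hεb
      refine (hat_le_coe_iff h0 (tail_nonneg hα.le N X) hε.le).2 fun Q hQ => ?_
      refine le_trans (lintegral_mono_ae ?_) (hcQ Q hQ)
      filter_upwards [hQ.1.ae_le (tail_ae α N X)] with ω h
      rw [h]
      have hN' : 2 * c ≤ N := (Nat.le_ceil _).trans (by exact_mod_cast hN)
      split_ifs with hcase
      · refine ENNReal.ofReal_le_ofReal ?_
        nlinarith
      · simp

variable (hz : ∃ Q ∈ domQ φ, penalty φ Q = 0)
include hz

theorem spaceMu_solid {X Y : L0 P} (hXY : |X| ≤ |Y|) (hY : Y ∈ spaceMu φ) : X ∈ spaceMu φ := by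
  rw [mem_spaceMu_iff h0 hz] at hY ⊢
  intro α hα ε hε
  obtain ⟨c, hc, h⟩ := hY α hα ε hε
  refine ⟨c, hc, fun Q hQ => (lintegral_mono_ae ?_).trans (h Q hQ)⟩
  rw [← AEEqFun.coeFn_le] at hXY
  filter_upwards [hQ.1.ae_le hXY, hQ.1.ae_le (AEEqFun.coeFn_abs X),
    hQ.1.ae_le (AEEqFun.coeFn_abs Y)] with ω h1 h2 h3
  rw [h2, h3] at h1
  refine ENNReal.ofReal_le_ofReal ?_
  gcongr

theorem Linf_subset_spaceMu : Linf P ⊆ spaceMu φ := by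
  intro X hX
  rw [mem_spaceMu_iff h0 hz]
  intro α hα ε hε
  obtain ⟨C, hC, hb⟩ := exists_bound_of_mem_Linf hX
  refine ⟨C, hC, fun Q hQ => le_trans (le_of_eq ?_) zero_le⟩
  rw [lintegral_eq_zero_iff' (by
    exact ((X.stronglyMeasurable.measurable.abs.sub_const C).const_mul
      α).ennreal_ofReal.aemeasurable)]
  filter_upwards [hQ.1.ae_le hb] with ω h
  simpa using mul_nonpos_of_nonneg_of_nonpos hα.le (by linarith : |X ω| - C ≤ 0)

theorem add_mem_spaceMu {X Y : L0 P} (hX : X ∈ spaceMu φ) (hY : Y ∈ spaceMu φ) :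
    X + Y ∈ spaceMu φ := by
  rw [mem_spaceMu_iff h0 hz] at hX hY ⊢
  intro α hα ε hε
  obtain ⟨c, hc, h⟩ := hX (2 * α) (by positivity) ε hε
  obtain ⟨d, hd, h'⟩ := hY (2 * α) (by positivity) ε hε
  refine ⟨c + d, by positivity, fun Q hQ => ?_⟩
  have hmX : Measurable fun ω => ENNReal.ofReal (2 * α * (|X ω| - c)) :=
    ((X.stronglyMeasurable.measurable.abs.sub_const c).const_mul _).ennreal_ofReal
  -- The excess of the sum above `c + d` is at most the sum of the excesses. Both sides are doubled
  -- so that the two bounds add up without halves.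
  have key : 2 * ∫⁻ ω, ENNReal.ofReal (α * (|(X + Y) ω| - (c + d))) ∂(Q : Measure Ω)
      ≤ 2 * ENNReal.ofReal (ε + penalty φ Q) := by
    rw [← lintegral_const_mul' _ _ (by simp)]
    calc _ ≤ ∫⁻ ω, (ENNReal.ofReal (2 * α * (|X ω| - c)) + ENNReal.ofReal (2 * α * (|Y ω| - d)))
          ∂(Q : Measure Ω) := by
          refine lintegral_mono_ae ?_
          filter_upwards [hQ.1.ae_le (AEEqFun.coeFn_add X Y)] with ω h1
          rw [h1, Pi.add_apply]
          have h2 : (2 : ℝ≥0∞) = ENNReal.ofReal 2 := by simp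
          rw [h2, ← ENNReal.ofReal_mul zero_le_two]
          refine le_trans (ENNReal.ofReal_le_ofReal ?_) ENNReal.ofReal_add_le
          nlinarith [abs_add_le (X ω) (Y ω)]
      _ = _ := lintegral_add_left hmX _
      _ ≤ _ := by rw [two_mul (ENNReal.ofReal _)]; exact add_le_add (h Q hQ) (h' Q hQ)
  exact (ENNReal.mul_le_mul_iff_right (by simp) (by simp)).1 key

theorem smul_mem_spaceMu (k : ℝ) {X : L0 P} (hX : X ∈ spaceMu φ) : k • X ∈ spaceMu φ := by
  by_cases hk : k = 0
  · rw [hk, zero_smul]; exact Linf_subset_spaceMu h0 hz zero_mem_Linf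
  rw [mem_spaceMu_iff h0 hz] at hX ⊢
  intro α hα ε hε
  have hk' : 0 < |k| := abs_pos.2 hk
  obtain ⟨c, hc, h⟩ := hX (α * |k|) (by positivity) ε hε
  refine ⟨|k| * c, by positivity, fun Q hQ => le_trans (lintegral_mono_ae ?_) (h Q hQ)⟩
  filter_upwards [hQ.1.ae_le (AEEqFun.coeFn_smul k X)] with ω h1
  rw [h1, Pi.smul_apply, smul_eq_mul, abs_mul]
  refine ENNReal.ofReal_le_ofReal (le_of_eq (by ring))

theorem isSolidSpace_spaceMu : IsSolidSpace (spaceMu φ) where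
  isSubspace := ⟨{ carrier := spaceMu φ
                   add_mem' := add_mem_spaceMu h0 hz
                   zero_mem' := Linf_subset_spaceMu h0 hz zero_mem_Linf
                   smul_mem' := fun k _ h => smul_mem_spaceMu h0 hz k h }, rfl⟩
  solid := fun _ _ h hY => spaceMu_solid h0 hz h hY

/-- Uniform control of the tails of an element of `spaceMu φ` by the penalty. -/
theorem exists_integral_tail_le {X : L0 P} (hX : X ∈ spaceMu φ) {α : ℝ} (hα : 0 < α) :
    ∃ c : ℝ, 0 ≤ c ∧ ∀ Q ∈ domQ φ, Integrable (fun ω => max (|X ω| - c) 0) (Q : Measure Ω) ∧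
      α * ∫ ω, max (|X ω| - c) 0 ∂(Q : Measure Ω) ≤ 1 + penalty φ Q := by
  obtain ⟨c, hc, h⟩ := (mem_spaceMu_iff h0 hz).1 hX α hα 1 one_pos
  refine ⟨c, hc, fun Q hQ => ?_⟩
  have hm : Measurable fun ω => max (|X ω| - c) 0 :=
    (X.stronglyMeasurable.measurable.abs.sub_const c).max measurable_const
  have hnn : ∀ ω, 0 ≤ α * max (|X ω| - c) 0 := fun ω => mul_nonneg hα.le (le_max_right _ _)
  have e : ∀ ω, ENNReal.ofReal (α * max (|X ω| - c) 0) = ENNReal.ofReal (α * (|X ω| - c)) := by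
    intro ω
    rcases le_total (|X ω| - c) 0 with h | h
    · rw [max_eq_right h, mul_zero, ENNReal.ofReal_zero,
        ENNReal.ofReal_of_nonpos (mul_nonpos_of_nonneg_of_nonpos hα.le h)]
    · rw [max_eq_left h]
  have hp := penalty_nonneg h0 Q
  have hl := h Q hQ
  simp_rw [← e] at hl
  constructor
  · have h1 : Integrable (fun ω => α * max (|X ω| - c) 0) (Q : Measure Ω) := by
      refine ⟨(hm.const_mul α).aestronglyMeasurable, ?_⟩
      rw [hasFiniteIntegral_iff_ofReal (Eventually.of_forall hnn)]
      exact hl.trans_lt ENNReal.ofReal_lt_top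
    have h2 := h1.const_mul α⁻¹
    simpa [inv_mul_cancel_left₀ hα.ne'] using h2
  · rw [← integral_const_mul, integral_eq_lintegral_of_nonneg_ae (Eventually.of_forall hnn)
      (hm.const_mul α).aestronglyMeasurable]
    exact ENNReal.toReal_le_of_le_ofReal (by positivity) hl

theorem integrable_of_mem_spaceMu {X : L0 P} (hX : X ∈ spaceMu φ) {Q : ProbabilityMeasure Ω}
    (hQ : Q ∈ domQ φ) : Integrable X (Q : Measure Ω) := by
  obtain ⟨c, -, h⟩ := exists_integral_tail_le h0 hz hX one_pos
  refine Integrable.mono' ((h Q hQ).1.add (integrable_const c))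
    X.stronglyMeasurable.aestronglyMeasurable (Eventually.of_forall fun ω => ?_)
  have := le_max_left (|X ω| - c) 0
  simp only [Pi.add_apply, Real.norm_eq_abs]
  linarith

theorem mem_coneD_of_mem_spaceMu {X : L0 P} (hX : X ∈ spaceMu φ) : X ∈ coneD φ := fun _ hQ =>
  (integrable_of_mem_spaceMu h0 hz hX hQ).neg.pos_part

theorem hat_eq_iSup_integral {X : L0 P} (hX : X ∈ spaceMu φ) :
    hat φ X = ⨆ Q ∈ domQ φ, ((∫ ω, X ω ∂(Q : Measure Ω) - penalty φ Q : ℝ) : EReal) := by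
  unfold hat
  refine iSup_congr fun Q => iSup_congr fun hQ => ?_
  rw [expect_of_integrable (integrable_of_mem_spaceMu h0 hz hX hQ), coe_penalty h0 hQ,
    EReal.coe_sub]

theorem coe_toReal_hat {X : L0 P} (hX : X ∈ spaceMu φ) : ((hat φ X).toReal : EReal) = hat φ X := by
  refine EReal.coe_toReal ?_ (hat_ne_bot h0 (hz.imp fun _ h => h.1)
    (mem_coneD_of_mem_spaceMu h0 hz hX))
  obtain ⟨c, -, h⟩ := exists_integral_tail_le h0 hz hX one_pos
  refine ne_top_of_le_ne_top (EReal.coe_ne_top (c + 1)) ?_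
  rw [hat_eq_iSup_integral h0 hz hX]
  refine iSup₂_le fun Q hQ => ?_
  have h1 := (h Q hQ).2
  have h2 : ∫ ω, X ω ∂(Q : Measure Ω) ≤ ∫ ω, (max (|X ω| - c) 0 + c) ∂(Q : Measure Ω) := by
    refine integral_mono (integrable_of_mem_spaceMu h0 hz hX hQ)
      ((h Q hQ).1.add (integrable_const c)) fun ω => ?_
    have := le_max_left (|X ω| - c) 0
    have := le_abs_self (X ω)
    simp only
    linarith
  rw [integral_add (h Q hQ).1 (integrable_const c)] at h2
  simp only [integral_const, probReal_univ, one_smul] at h2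
  have : ∫ ω, X ω ∂(Q : Measure Ω) - penalty φ Q ≤ c + 1 := by linarith
  exact_mod_cast this

theorem integral_sub_penalty_le_hat {X : L0 P} (hX : X ∈ spaceMu φ) {Q : ProbabilityMeasure Ω}
    (hQ : Q ∈ domQ φ) : ∫ ω, X ω ∂(Q : Measure Ω) - penalty φ Q ≤ (hat φ X).toReal := by
  have h := le_iSup₂ (f := fun (Q : ProbabilityMeasure Ω) (_ : Q ∈ domQ φ) =>
    ((∫ ω, X ω ∂(Q : Measure Ω) - penalty φ Q : ℝ) : EReal)) Q hQ
  rw [← hat_eq_iSup_integral h0 hz hX, ← coe_toReal_hat h0 hz hX] at h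
  exact_mod_cast h

theorem toReal_hat_le {X : L0 P} (hX : X ∈ spaceMu φ) {r : ℝ}
    (h : ∀ Q ∈ domQ φ, ∫ ω, X ω ∂(Q : Measure Ω) - penalty φ Q ≤ r) : (hat φ X).toReal ≤ r := by
  have h1 : hat φ X ≤ r := by
    rw [hat_eq_iSup_integral h0 hz hX]
    exact iSup₂_le fun Q hQ => by exact_mod_cast h Q hQ
  rw [← coe_toReal_hat h0 hz hX] at h1
  exact_mod_cast h1

theorem isConvexRiskFunctionOn_hat : IsConvexRiskFunctionOn (spaceMu φ) (hat φ) where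
  ne_bot X hX := by rw [← coe_toReal_hat h0 hz hX]; exact EReal.coe_ne_bot _
  proper := by
    have hX := Linf_subset_spaceMu h0 hz (zero_mem_Linf (P := P))
    exact ⟨0, hX, by rw [← coe_toReal_hat h0 hz hX]; exact EReal.coe_ne_top _⟩
  convex X hX Y hY a b ha hb hab := by
    have haX := smul_mem_spaceMu h0 hz a hX
    have hbY := smul_mem_spaceMu h0 hz b hY
    have hs := add_mem_spaceMu h0 hz haX hbY
    rw [← coe_toReal_hat h0 hz hX, ← coe_toReal_hat h0 hz hY, ← coe_toReal_hat h0 hz hs]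
    have : (hat φ (a • X + b • Y)).toReal ≤ a * (hat φ X).toReal + b * (hat φ Y).toReal := by
      refine toReal_hat_le h0 hz hs fun Q hQ => ?_
      have e : ∫ ω, (a • X + b • Y) ω ∂(Q : Measure Ω)
          = a * ∫ ω, X ω ∂(Q : Measure Ω) + b * ∫ ω, Y ω ∂(Q : Measure Ω) := by
        rw [← integral_const_mul, ← integral_const_mul, ← integral_add
          ((integrable_of_mem_spaceMu h0 hz hX hQ).const_mul a)
          ((integrable_of_mem_spaceMu h0 hz hY hQ).const_mul b)]
        refine integral_congr_ae ?_
        filter_upwards [hQ.1.ae_le (AEEqFun.coeFn_add (a • X) (b • Y)),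
          hQ.1.ae_le (AEEqFun.coeFn_smul a X), hQ.1.ae_le (AEEqFun.coeFn_smul b Y)]
          with ω h1 h2 h3
        rw [h1, Pi.add_apply, h2, h3]
        rfl
      have hp : penalty φ Q = a * penalty φ Q + b * penalty φ Q := by rw [← add_mul, hab, one_mul]
      have h1 := mul_le_mul_of_nonneg_left (integral_sub_penalty_le_hat h0 hz hX hQ) ha.le
      have h2 := mul_le_mul_of_nonneg_left (integral_sub_penalty_le_hat h0 hz hY hQ) hb.le
      rw [e]
      linarith
    exact_mod_cast this
  mono X hX Y hY hXY := by
    rw [← coe_toReal_hat h0 hz hX, ← coe_toReal_hat h0 hz hY]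
    have : (hat φ X).toReal ≤ (hat φ Y).toReal := by
      refine toReal_hat_le h0 hz hX fun Q hQ => ?_
      refine le_trans ?_ (integral_sub_penalty_le_hat h0 hz hY hQ)
      refine sub_le_sub_right (integral_mono_ae (integrable_of_mem_spaceMu h0 hz hX hQ)
        (integrable_of_mem_spaceMu h0 hz hY hQ) ?_) _
      exact hQ.1.ae_le (AEEqFun.coeFn_le.2 hXY)
    exact_mod_cast this
  cash_additive X hX c := by
    have hc := Linf_subset_spaceMu h0 hz (const_mem_Linf (P := P) c)
    have hs := add_mem_spaceMu h0 hz hX hc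
    refine ⟨hs, ?_⟩
    have e : ∀ Q ∈ domQ φ, ∫ ω, (X + AEEqFun.const Ω c : L0 P) ω ∂(Q : Measure Ω)
        = ∫ ω, X ω ∂(Q : Measure Ω) + c := by
      intro Q hQ
      have : ∫ ω, (X + AEEqFun.const Ω c : L0 P) ω ∂(Q : Measure Ω)
          = ∫ ω, (X ω + c) ∂(Q : Measure Ω) := by
        refine integral_congr_ae ?_
        filter_upwards [hQ.1.ae_le (AEEqFun.coeFn_add X (AEEqFun.const Ω c)),
          hQ.1.ae_le (AEEqFun.coeFn_const (μ := P) (α := Ω) c)] with ω h1 h2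
        rw [h1, Pi.add_apply, h2]
        rfl
      rw [this, integral_add (integrable_of_mem_spaceMu h0 hz hX hQ) (integrable_const c)]
      simp
    rw [← coe_toReal_hat h0 hz hX, ← coe_toReal_hat h0 hz hs, ← EReal.coe_add]
    congr 1
    refine le_antisymm (toReal_hat_le h0 hz hs fun Q hQ => ?_) ?_
    · rw [e Q hQ]
      have := integral_sub_penalty_le_hat h0 hz hX hQ
      linarith
    · rw [← le_sub_iff_add_le]
      refine toReal_hat_le h0 hz hX fun Q hQ => ?_
      have := integral_sub_penalty_le_hat h0 hz hs hQ
      rw [e Q hQ] at this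
      linarith

/-- On random variables dominated by `Y`, `hat φ` is uniformly insensitive to perturbations
dominated by the tail of `Y`. -/
theorem exists_toReal_hat_le_add {Y : L0 P} (hY : Y ∈ spaceMu φ) {ε : ℝ} (hε : 0 < ε) :
    ∃ c : ℝ, 0 ≤ c ∧ ∀ X X' : L0 P, |X| ≤ |Y| → |X'| ≤ |Y| →
      (∀ᵐ ω ∂P, X ω - X' ω ≤ max (|Y ω| - c) 0) →
      (hat φ X).toReal ≤ (hat φ X').toReal + ε := by
  obtain ⟨Q₀, hQ₀, hp₀⟩ := id hz
  obtain ⟨d, hd, h⟩ := exists_integral_tail_le h0 hz hY two_pos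
  set m := ∫ ω, |Y ω| ∂(Q₀ : Measure Ω) with hm
  have hm0 : 0 ≤ m := integral_nonneg fun _ => abs_nonneg _
  -- If `penalty φ Q ≥ K`, the tail bound with `α = 2` gives `E_Q[X] - penalty φ Q ≤ d + 1/2 -
  -- penalty φ Q / 2 ≤ -m`, and `-m ≤ E_{Q₀}[X'] ≤ φ̂(X')` since `Q₀` has zero penalty.
  set K := 2 * (d + m) + 1 with hK
  have hK0 : 0 ≤ K := by positivity
  -- With this `α`, a penalty of at most `K` forces the expected excess of `Y` above `c` to be at
  -- most `ε`.
  obtain ⟨c, hc, h'⟩ := exists_integral_tail_le h0 hz hY (α := (1 + K) / ε) (by positivity)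
  refine ⟨c, hc, fun X X' hX hX' hXX' => ?_⟩
  have hXm := spaceMu_solid h0 hz hX hY
  have hXm' := spaceMu_solid h0 hz hX' hY
  refine toReal_hat_le h0 hz hXm fun Q hQ => ?_
  have iX := integrable_of_mem_spaceMu h0 hz hXm hQ
  have iX' := integrable_of_mem_spaceMu h0 hz hXm' hQ
  rcases le_total (penalty φ Q) K with hcase | hcase
  · have h1 := (h' Q hQ).2
    have h2 : ∫ ω, max (|Y ω| - c) 0 ∂(Q : Measure Ω) ≤ ε := by
      rw [div_mul_eq_mul_div, div_le_iff₀ hε] at h1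
      have h3 : (1 + K) * ∫ ω, max (|Y ω| - c) 0 ∂(Q : Measure Ω) ≤ (1 + K) * ε :=
        h1.trans (by gcongr)
      exact le_of_mul_le_mul_left h3 (by positivity)
    have h3 : ∫ ω, X ω ∂(Q : Measure Ω)
        ≤ ∫ ω, (X' ω + max (|Y ω| - c) 0) ∂(Q : Measure Ω) := by
      refine integral_mono_ae iX (iX'.add (h' Q hQ).1) ?_
      filter_upwards [hQ.1.ae_le hXX'] with ω h
      linarith
    rw [integral_add iX' (h' Q hQ).1] at h3
    have := integral_sub_penalty_le_hat h0 hz hXm' hQ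
    linarith
  · have h1 := (h Q hQ).2
    have h2 : ∫ ω, X ω ∂(Q : Measure Ω) ≤ ∫ ω, (max (|Y ω| - d) 0 + d) ∂(Q : Measure Ω) := by
      refine integral_mono_ae iX ((h Q hQ).1.add (integrable_const d)) ?_
      filter_upwards [hQ.1.ae_le (AEEqFun.coeFn_le.2 hX), hQ.1.ae_le (AEEqFun.coeFn_abs X),
        hQ.1.ae_le (AEEqFun.coeFn_abs Y)] with ω h1 h2 h3
      rw [h2, h3] at h1
      have := le_max_left (|Y ω| - d) 0
      have := le_abs_self (X ω)
      linarith
    rw [integral_add (h Q hQ).1 (integrable_const d)] at h2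
    simp only [integral_const, probReal_univ, one_smul] at h2
    have h3 : -m ≤ ∫ ω, X' ω ∂(Q₀ : Measure Ω) := by
      rw [hm, ← integral_neg]
      refine integral_mono_ae (integrable_of_mem_spaceMu h0 hz hY hQ₀).abs.neg
        (integrable_of_mem_spaceMu h0 hz hXm' hQ₀) ?_
      filter_upwards [hQ₀.1.ae_le (AEEqFun.coeFn_le.2 hX'), hQ₀.1.ae_le (AEEqFun.coeFn_abs X'),
        hQ₀.1.ae_le (AEEqFun.coeFn_abs Y)] with ω h1 h2 h3
      rw [h2, h3] at h1
      have := neg_abs_le (X' ω)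
      linarith
    have h4 := integral_sub_penalty_le_hat h0 hz hXm' hQ₀
    linarith
end

/-! ### Truncations -/

/-- The truncation of `X` to the interval `[-c, c]`. -/
noncomputable def trunc (c : ℝ) (X : L0 P) : L0 P :=
  AEEqFun.comp (fun x : ℝ => max (-c) (min x c)) (by fun_prop) X

theorem trunc_ae (c : ℝ) (X : L0 P) : ∀ᵐ ω ∂P, trunc c X ω = max (-c) (min (X ω) c) :=
  AEEqFun.coeFn_comp _ _ X

theorem abs_max_min_le {c : ℝ} (hc : 0 ≤ c) (x : ℝ) : |max (-c) (min x c)| ≤ c :=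
  abs_le.2 ⟨le_max_left _ _, max_le (by linarith) (min_le_right _ _)⟩

theorem abs_max_min_le_abs {c : ℝ} (hc : 0 ≤ c) (x : ℝ) : |max (-c) (min x c)| ≤ |x| := by
  grind

theorem trunc_mem_Linf {c : ℝ} (hc : 0 ≤ c) (X : L0 P) : trunc c X ∈ Linf P := by
  refine mem_Linf_of_bound c ?_
  filter_upwards [trunc_ae c X] with ω h
  rw [h]; exact abs_max_min_le hc _

theorem abs_trunc_le {c : ℝ} (hc : 0 ≤ c) (X : L0 P) : |trunc c X| ≤ |X| := by
  rw [← AEEqFun.coeFn_le]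
  filter_upwards [trunc_ae c X, AEEqFun.coeFn_abs X, AEEqFun.coeFn_abs (trunc c X)] with ω h h1 h2
  rw [h2, h1, h]
  exact abs_max_min_le_abs hc _

theorem tendsto_trunc (X : L0 P) :
    ∀ᵐ ω ∂P, Tendsto (fun n : ℕ => trunc (n : ℝ) X ω) atTop (𝓝 (X ω)) := by
  filter_upwards [ae_all_iff.2 fun n : ℕ => trunc_ae (n : ℝ) X] with ω h
  simp_rw [h]
  refine tendsto_const_nhds.congr' ?_
  filter_upwards [eventually_ge_atTop ⌈|X ω|⌉₊] with n hn
  have hn' : |X ω| ≤ n := (Nat.le_ceil _).trans (by exact_mod_cast hn)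
  rw [min_eq_left (abs_le.1 hn').2, max_eq_right (abs_le.1 hn').1]

/-! ### Agreement on bounded variables and the Lebesgue property -/

section
variable [IsProbabilityMeasure P] {φ : L0 P → EReal} (hφ : IsConvexRiskFunctionOn (Linf P) φ)
  (hL : HasLebesgueProperty (Linf P) φ) (h0 : φ 0 = 0)
include hφ hL h0

theorem hat_eq_of_mem_Linf {X : L0 P} (hX : X ∈ Linf P) : hat φ X = φ X := by
  have hz := exists_penalty_eq_zero h0 hφ hL
  have hXm := Linf_subset_spaceMu h0 hz hX
  rw [← coe_toReal_hat h0 hz hXm, ← hφ.coe_toReal h0 hX]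
  congr 1
  refine le_antisymm
    (toReal_hat_le h0 hz hXm fun Q hQ => integral_sub_penalty_le h0 hφ hQ hX) ?_
  obtain ⟨Q, hQ, h⟩ := exists_eq_integral_sub_penalty h0 hφ hL hX
  rw [h]
  exact integral_sub_penalty_le_hat h0 hz hXm hQ

/-- Truncation at `c` moves `X` by `(|X| - c)⁺ ≤ (|Y| - c)⁺`, a perturbation to which `hat φ` is
insensitive. The level `c` depends on `Y` only, which gives the uniformity needed along dominated
sequences. -/
theorem exists_abs_toReal_hat_sub_trunc_le {Y : L0 P} (hY : Y ∈ spaceMu φ) {ε : ℝ} (hε : 0 < ε) :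
    ∃ c : ℝ, 0 ≤ c ∧ ∀ X : L0 P, |X| ≤ |Y| →
      |(hat φ X).toReal - (φ (trunc c X)).toReal| ≤ ε := by
  obtain ⟨c, hc, h⟩ := exists_toReal_hat_le_add h0 (exists_penalty_eq_zero h0 hφ hL) hY hε
  refine ⟨c, hc, fun X hX => ?_⟩
  have hT := (abs_trunc_le hc X).trans hX
  rw [← hat_eq_of_mem_Linf hφ hL h0 (trunc_mem_Linf hc X), abs_sub_le_iff]
  have key : ∀ᵐ ω ∂P, |X ω - trunc c X ω| ≤ max (|Y ω| - c) 0 := by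
    filter_upwards [trunc_ae c X, AEEqFun.coeFn_le.2 hX, AEEqFun.coeFn_abs X,
      AEEqFun.coeFn_abs Y] with ω h1 h2 h3 h4
    rw [h3, h4] at h2
    rw [h1]
    grind
  have h1 := h X (trunc c X) hX hT (by
    filter_upwards [key] with ω hω using (le_abs_self _).trans hω)
  have h2 := h (trunc c X) X hT hX (by
    filter_upwards [key] with ω hω
    rw [abs_sub_comm] at hω
    exact (le_abs_self _).trans hω)
  constructor <;> linarith

theorem hasLebesgueProperty_hat : HasLebesgueProperty (spaceMu φ) (hat φ) := by
  intro X X' hX ⟨Y, hY, hY0, hXY⟩ ht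
  have hz := exists_penalty_eq_zero h0 hφ hL
  have hYa : |Y| = Y := by
    apply AEEqFun.ext
    filter_upwards [AEEqFun.coeFn_abs Y, AEEqFun.coeFn_le.2 hY0,
      AEEqFun.coeFn_zero (μ := P) (β := ℝ)] with ω h1 h2 h3
    rw [h3] at h2
    rw [h1]
    exact abs_of_nonneg h2
  have hXY' : |X'| ≤ Y := by
    rw [← AEEqFun.coeFn_le]
    filter_upwards [ht, ae_all_iff.2 fun n => AEEqFun.coeFn_le.2 (hXY n), AEEqFun.coeFn_abs X',
      ae_all_iff.2 fun n => AEEqFun.coeFn_abs (X n)] with ω h1 h2 h3 h4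
    rw [h3]
    exact le_of_tendsto h1.abs (Eventually.of_forall fun n => by rw [← h4]; exact h2 n)
  have hX' : X' ∈ spaceMu φ := spaceMu_solid h0 hz (hXY'.trans hYa.ge) hY
  suffices h : Tendsto (fun n => (hat φ (X n)).toReal) atTop (𝓝 (hat φ X').toReal) by
    have h2 := (continuous_coe_real_ereal.tendsto _).comp h
    rw [coe_toReal_hat h0 hz hX'] at h2
    refine h2.congr fun n => ?_
    exact coe_toReal_hat h0 hz (hX n)
  rw [Metric.tendsto_atTop]
  intro ε hε
  obtain ⟨c, hc, h⟩ := exists_abs_toReal_hat_sub_trunc_le hφ hL h0 hY (ε := ε / 4) (by positivity)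
  have htr : Tendsto (fun n => φ (trunc c (X n))) atTop (𝓝 (φ (trunc c X'))) := by
    refine hL _ _ (fun n => trunc_mem_Linf hc _) ⟨AEEqFun.const Ω c, const_mem_Linf c, ?_, ?_⟩ ?_
    · rw [← AEEqFun.coeFn_le]
      filter_upwards [AEEqFun.coeFn_zero (μ := P) (β := ℝ),
        AEEqFun.coeFn_const (μ := P) (α := Ω) c] with ω h1 h2
      rw [h1, h2]; exact hc
    · intro n
      rw [← AEEqFun.coeFn_le]
      filter_upwards [AEEqFun.coeFn_abs (trunc c (X n)), trunc_ae c (X n),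
        AEEqFun.coeFn_const (μ := P) (α := Ω) c] with ω h1 h2 h3
      rw [h1, h2, h3]; exact abs_max_min_le hc _
    · filter_upwards [ht, trunc_ae c X', ae_all_iff.2 fun n => trunc_ae c (X n)] with ω h1 h2 h3
      simp_rw [h2, h3]
      exact tendsto_const_nhds.max (h1.min tendsto_const_nhds)
  have htr' := (EReal.tendsto_toReal (hφ.ne_top h0 (trunc_mem_Linf hc X'))
    (hφ.ne_bot _ (trunc_mem_Linf hc X'))).comp htr
  obtain ⟨N, hN⟩ := Metric.tendsto_atTop.1 htr' (ε / 4) (by positivity)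
  refine ⟨N, fun n hn => ?_⟩
  have h1 := abs_le.1 (h (X n) ((hXY n).trans hYa.ge))
  have h2 := abs_le.1 (h X' (hXY'.trans hYa.ge))
  have h3 := hN n hn
  rw [Real.dist_eq, abs_lt] at h3 ⊢
  simp only [Function.comp_apply] at h3
  constructor <;> linarith

/-! ### Maximality and uniqueness -/

variable {S : Set (L0 P)} {ψ : L0 P → EReal} (hS : IsSolidSpace S) (hLS : Linf P ⊆ S)
  (hψ : IsConvexRiskFunctionOn S ψ) (hψL : HasLebesgueProperty S ψ)
  (hext : ∀ X ∈ Linf P, ψ X = φ X)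
include hLS hψ hext

-- For bounded `min Y k`, Fenchel's inequality and monotonicity of `ψ` give `E_Q[min Y k] - penalty
-- φ Q ≤ ψ Y`; monotone convergence removes `k`.
omit hL in
theorem lintegral_le_of_extension_le {Y : L0 P} (hY : Y ∈ S) (hY0 : 0 ≤ Y) {r : ℝ}
    (hr : ψ Y ≤ r) {Q : ProbabilityMeasure Ω} (hQ : Q ∈ domQ φ) :
    ∫⁻ ω, ENNReal.ofReal (Y ω) ∂(Q : Measure Ω) ≤ ENNReal.ofReal (r + penalty φ Q) := by
  have hY0' : ∀ᵐ ω ∂P, 0 ≤ Y ω := by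
    filter_upwards [AEEqFun.coeFn_le.2 hY0, AEEqFun.coeFn_zero (μ := P) (β := ℝ)] with ω h1 h2
    rw [h2] at h1
    exact h1
  have hk : ∀ k : ℕ, ∫⁻ ω, ENNReal.ofReal (min (Y ω) k) ∂(Q : Measure Ω)
      ≤ ENNReal.ofReal (r + penalty φ Q) := by
    intro k
    have hk0 : (0 : ℝ) ≤ k := Nat.cast_nonneg k
    have hT := trunc_mem_Linf hk0 Y
    have hmin : ∀ᵐ ω ∂(Q : Measure Ω), trunc (k : ℝ) Y ω = min (Y ω) k ∧ 0 ≤ min (Y ω) k := by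
      filter_upwards [hQ.1.ae_le (trunc_ae (k : ℝ) Y), hQ.1.ae_le hY0'] with ω h1 h2
      have h3 : 0 ≤ min (Y ω) k := le_min h2 hk0
      exact ⟨by rw [h1]; exact max_eq_right (by linarith), h3⟩
    have hle : trunc (k : ℝ) Y ≤ Y := by
      rw [← AEEqFun.coeFn_le]
      filter_upwards [trunc_ae (k : ℝ) Y, hY0'] with ω h1 h2
      rw [h1]
      exact max_le (by linarith) (min_le_left _ _)
    have h1 : φ (trunc (k : ℝ) Y) ≤ r := by
      rw [← hext _ hT]
      exact (hψ.mono _ (hLS hT) _ hY hle).trans hr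
    rw [← hφ.coe_toReal h0 hT] at h1
    have h2 : (φ (trunc (k : ℝ) Y)).toReal ≤ r := by exact_mod_cast h1
    have h3 := integral_sub_penalty_le h0 hφ hQ hT
    have hint : Integrable (fun ω => min (Y ω) (k : ℝ)) (Q : Measure Ω) := by
      refine Integrable.mono' (integrable_const (k : ℝ))
        (Y.stronglyMeasurable.measurable.min measurable_const).aestronglyMeasurable ?_
      filter_upwards [hmin] with ω h
      rw [Real.norm_of_nonneg h.2]
      exact min_le_right _ _
    rw [← ofReal_integral_eq_lintegral_ofReal hint (hmin.mono fun ω h => h.2)]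
    refine ENNReal.ofReal_le_ofReal ?_
    rw [← integral_congr_ae (hmin.mono fun ω h => h.1)]
    linarith
  have hlim : Tendsto (fun k : ℕ => ∫⁻ ω, ENNReal.ofReal (min (Y ω) k) ∂(Q : Measure Ω)) atTop
      (𝓝 (∫⁻ ω, ENNReal.ofReal (Y ω) ∂(Q : Measure Ω))) := by
    refine lintegral_tendsto_of_tendsto_of_monotone (fun k =>
      (Y.stronglyMeasurable.measurable.min measurable_const).ennreal_ofReal.aemeasurable)
      (Eventually.of_forall fun ω i j hij => ?_) (Eventually.of_forall fun ω => ?_)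
    · refine ENNReal.ofReal_le_ofReal (min_le_min le_rfl ?_)
      exact_mod_cast hij
    · refine tendsto_const_nhds.congr' ?_
      filter_upwards [eventually_ge_atTop ⌈Y ω⌉₊] with n hn
      have hn' : Y ω ≤ n := (Nat.le_ceil _).trans (by exact_mod_cast hn)
      rw [min_eq_left hn']
  exact le_of_tendsto hlim (Eventually.of_forall hk)

include hS hψL

theorem subset_spaceMu_of_extension : S ⊆ spaceMu φ := by
  intro X hX
  rw [mem_spaceMu_iff h0 (exists_penalty_eq_zero h0 hφ hL)]
  intro α hα ε hε
  have hcont : ∀ n : ℕ, Continuous fun x : ℝ => max (α * (|x| - n)) 0 := fun n => by fun_prop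
  -- The excesses `α(|X| - n)⁺` lie in `S` by solidity, are dominated by `|α • X|` and vanish
  -- pointwise for large `n`, so the Lebesgue property of `ψ` applies.
  let Y : ℕ → L0 P := fun n => AEEqFun.comp _ (hcont n) X
  have hYae : ∀ n, ∀ᵐ ω ∂P, Y n ω = max (α * (|X ω| - n)) 0 := fun n =>
    AEEqFun.coeFn_comp _ (hcont n) X
  have hαX : α • X ∈ S := by
    obtain ⟨V, rfl⟩ := hS.isSubspace
    exact V.smul_mem α hX
  have habs : ∀ Z : L0 P, |(|Z|)| = |Z| := by
    intro Z
    apply AEEqFun.ext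
    filter_upwards [AEEqFun.coeFn_abs Z, AEEqFun.coeFn_abs |Z|] with ω h1 h2
    rw [h2, h1, abs_abs]
  have hYdom : ∀ n, |Y n| ≤ |α • X| := by
    intro n
    rw [← AEEqFun.coeFn_le]
    filter_upwards [hYae n, AEEqFun.coeFn_abs (Y n), AEEqFun.coeFn_abs (α • X),
      AEEqFun.coeFn_smul α X] with ω h1 h2 h3 h4
    rw [h2, h3, h4, h1, abs_of_nonneg (le_max_right _ _), Pi.smul_apply, smul_eq_mul, abs_mul,
      abs_of_pos hα]
    refine max_le ?_ (by positivity)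
    gcongr
    simp
  have hYS : ∀ n, Y n ∈ S := fun n => hS.solid _ _ (hYdom n) hαX
  have hYpos : ∀ n, 0 ≤ Y n := by
    intro n
    rw [← AEEqFun.coeFn_le]
    filter_upwards [hYae n, AEEqFun.coeFn_zero (μ := P) (β := ℝ)] with ω h1 h2
    rw [h1, h2]
    exact le_max_right _ _
  have hlim : Tendsto (fun n => ψ (Y n)) atTop (𝓝 (ψ 0)) := by
    refine hψL Y 0 hYS ⟨|α • X|, hS.solid _ _ (habs _).le hαX, ?_, hYdom⟩ ?_
    · rw [← AEEqFun.coeFn_le]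
      filter_upwards [AEEqFun.coeFn_zero (μ := P) (β := ℝ), AEEqFun.coeFn_abs (α • X)]
        with ω h1 h2
      rw [h1, h2]
      exact abs_nonneg _
    · filter_upwards [ae_all_iff.2 hYae, AEEqFun.coeFn_zero (μ := P) (β := ℝ)] with ω h1 h2
      simp_rw [h1, h2]
      refine tendsto_const_nhds.congr' ?_
      filter_upwards [eventually_ge_atTop ⌈|X ω|⌉₊] with n hn
      have hn' : |X ω| ≤ n := (Nat.le_ceil _).trans (by exact_mod_cast hn)
      rw [max_eq_right (mul_nonpos_of_nonneg_of_nonpos hα.le (by linarith))]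
      rfl
  rw [hext 0 zero_mem_Linf, h0] at hlim
  obtain ⟨N, hN⟩ := (hlim.eventually_lt_const
    (show (0 : EReal) < (ε : EReal) by exact_mod_cast hε)).exists
  refine ⟨N, Nat.cast_nonneg N, fun Q hQ => le_trans (lintegral_mono_ae ?_)
    (lintegral_le_of_extension_le hφ h0 hLS hψ hext (hYS N) (hYpos N) hN.le hQ)⟩
  filter_upwards [hQ.1.ae_le (hYae N)] with ω h
  rw [h]
  exact ENNReal.ofReal_le_ofReal (le_max_left _ _)

theorem eq_hat_of_extension {X : L0 P} (hX : X ∈ S) : ψ X = hat φ X := by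
  have hsub := subset_spaceMu_of_extension hφ hL h0 hS hLS hψ hψL hext
  -- Stated for every solid `T`, because the dominating element is needed both in `S` for `ψ` and in
  -- `spaceMu φ` for `hat φ`.
  have hdom : ∀ T : Set (L0 P), IsSolidSpace T → X ∈ T →
      ∃ Y ∈ T, 0 ≤ Y ∧ ∀ n : ℕ, |trunc (n : ℝ) X| ≤ Y := by
    intro T hT hXT
    refine ⟨|X|, hT.solid _ X ?_ hXT, ?_, fun n => abs_trunc_le (Nat.cast_nonneg n) X⟩
    · rw [← AEEqFun.coeFn_le]
      filter_upwards [AEEqFun.coeFn_abs X, AEEqFun.coeFn_abs |X|] with ω h1 h2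
      rw [h2, h1, abs_abs]
    · rw [← AEEqFun.coeFn_le]
      filter_upwards [AEEqFun.coeFn_zero (μ := P) (β := ℝ), AEEqFun.coeFn_abs X] with ω h1 h2
      rw [h1, h2]
      exact abs_nonneg _
  have hz := exists_penalty_eq_zero h0 hφ hL
  have hTL : ∀ n : ℕ, trunc (n : ℝ) X ∈ Linf P := fun n => trunc_mem_Linf (Nat.cast_nonneg n) X
  have t1 := hψL (fun n : ℕ => trunc (n : ℝ) X) X (fun n => hLS (hTL n)) (hdom S hS hX)
    (tendsto_trunc X)
  have t2 := hasLebesgueProperty_hat hφ hL h0 (fun n : ℕ => trunc (n : ℝ) X) X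
    (fun n => Linf_subset_spaceMu h0 hz (hTL n))
    (hdom _ (isSolidSpace_spaceMu h0 hz) (hsub hX)) (tendsto_trunc X)
  refine tendsto_nhds_unique t1 (t2.congr fun n => ?_)
  rw [hat_eq_of_mem_Linf hφ hL h0 (hTL n), hext _ (hTL n)]
end

end RiskFunction

open RiskFunction in
theorem mainTheorem7 {Ω : Type*} [MeasurableSpace Ω] (P : Measure Ω) [IsProbabilityMeasure P]
    (φ₀ : L0 P → EReal) (hφ₀ : IsConvexRiskFunctionOn (Linf P) φ₀)
    (hLeb : HasLebesgueProperty (Linf P) φ₀) (hzero : φ₀ 0 = 0) :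
    -- well-definedness
    ((domQ φ₀).Nonempty ∧
      (∀ Q ∈ domQ φ₀, ∃ r : ℝ, conjugate φ₀ (density P Q) = (r : EReal)) ∧
      (∀ X ∈ coneD φ₀, (∀ Q ∈ domQ φ₀, expect Q X ≠ ⊥) ∧ hat φ₀ X ≠ ⊥) ∧
      (∀ X : L0 P, 0 ≤ X → X ∈ coneD φ₀) ∧
      (∀ X ∈ spaceMu φ₀, X ∈ coneD φ₀ ∧ -X ∈ coneD φ₀)) ∧
    -- the pair is a finite Lebesgue extension
    (IsSolidSpace (spaceMu φ₀) ∧ Linf P ⊆ spaceMu φ₀ ∧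
      IsConvexRiskFunctionOn (spaceMu φ₀) (hat φ₀) ∧
      (∀ X ∈ spaceMu φ₀, ∃ r : ℝ, hat φ₀ X = (r : EReal)) ∧
      HasLebesgueProperty (spaceMu φ₀) (hat φ₀) ∧
      (∀ X ∈ Linf P, hat φ₀ X = φ₀ X)) ∧
    -- maximality
    (∀ (S : Set (L0 P)) (φ : L0 P → EReal), IsSolidSpace S → Linf P ⊆ S →
      IsConvexRiskFunctionOn S φ → HasLebesgueProperty S φ →
      (∀ X ∈ Linf P, φ X = φ₀ X) →
      S ⊆ spaceMu φ₀ ∧ ∀ X ∈ S, φ X = hat φ₀ X) := by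
  have hz := exists_penalty_eq_zero hzero hφ₀ hLeb
  have hne : (domQ φ₀).Nonempty := hz.imp fun _ h => h.1
  refine ⟨⟨hne, fun Q hQ => ⟨_, coe_penalty hzero hQ⟩,
      fun X hX => ⟨fun Q hQ => expect_ne_bot (hX Q hQ), hat_ne_bot hzero hne hX⟩,
      fun X hX => mem_coneD_of_nonneg hX, fun X hX => ⟨mem_coneD_of_mem_spaceMu hzero hz hX, ?_⟩⟩,
    ⟨isSolidSpace_spaceMu hzero hz, Linf_subset_spaceMu hzero hz,
      isConvexRiskFunctionOn_hat hzero hz, fun X hX => ⟨_, (coe_toReal_hat hzero hz hX).symm⟩,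
      hasLebesgueProperty_hat hφ₀ hLeb hzero, fun X hX => hat_eq_of_mem_Linf hφ₀ hLeb hzero hX⟩,
    fun S φ hS hLS hφ hφL hext => ⟨subset_spaceMu_of_extension hφ₀ hLeb hzero hS hLS hφ hφL hext,
      fun X hX => eq_hat_of_extension hφ₀ hLeb hzero hS hLS hφ hφL hext hX⟩⟩
  have h := smul_mem_spaceMu hzero hz (-1) hX
  rw [neg_one_smul] at h
  exact mem_coneD_of_mem_spaceMu hzero hz h
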